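/- For $n\in\mathbb N$ let $N=\{1,\dots,n\}$ and for $I\subseteq N$ let $x_I\in\{0,1\}^n$ be the indicator vector of $I$. For $q\ge 0$ let $Z_I$ be the $0/1$ vector indexed by the sets $J\subseteq N$ with $|J|\le q$, whose $J$-th entry is $1$ if and only if $J\subseteq I$. Given a set $P=\{x\in\{0,1\}^n : g_\ell(x)\ge 0\ \text{for all }\ell\}$ described by linear (affine) constraints $g_\ell$, its level-$t$ Sum-of-Squares (Lasserre) relaxation $\mathrm{SoS}_t(P)$, $t\ge 0$, is the set of all $y=(y_I)_{I\subseteq N}\in\mathbb R^{2^n}$ such that $$\sum_{I\subseteq N} y_I=1,\qquad \sum_{I\subseteq N} y_I Z_IZ_I^\top\succeq 0\ \ (q=t+1),\qquad \sum_{I\subseteq N} g_\ell(x_I)\,y_I Z_IZ_I^\top\succeq 0\ \ (q=t)\ \text{ for all }\ell .$$ The vector $y$ is projected to $x\in\mathbb R^n$ by $x_i=\sum_{I\ni i}y_I$, and the SoS rank $\rho(P)$ is the smallest $t$ such that the projection of $\mathrm{SoS}_t(P)$ equals the convex hull of $P$. **Theorem.** Let $$K=K_n=\{0,1\}^n\cap\Big\{x\in[0,1]^n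 : \sum_{r\in R}x_r+\sum_{r\in N\setminus R}(1-x_r)\ge \tfrac12\ \text{ for all }R\subseteq N\Big\},$$ described by these $2^n$ constraints. Then $K_n=\emptyset$ for every $n$, and the SoS rank of $K_n$ satisfies $$\Omega(\sqrt n)\ \le\ \rho(K_n)\ \le\ n-\Omega(n^{1/3}),$$ that is, there are constants $c,C>0$ and $n_0$ such that for all $n\ge n_0$ the rank $\rho(K_n)$ exists and $c\sqrt n\le\rho(K_n)\le n-Cn^{1/3}$. In particular $\rho(K_n)<n-1$ for all sufficiently large $n$, so Laurent's conjecture that $\rho(K_n)=n-1$ is false. -/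

import Mathlib

namespace SoSHierarchy

/-- The `0/1` point `x_I` with `x_i = 1` for `i ∈ I` and `x_i = 0` for `i ∉ I`. -/
def cubePoint {n : ℕ} (I : Finset (Fin n)) : Fin n → ℝ :=
  fun i => if i ∈ I then 1 else 0

/-- The `0/1` cube in `ℝⁿ`. -/
def cube (n : ℕ) : Set (Fin n → ℝ) :=
  {x | ∀ i, x i = 0 ∨ x i = 1}

/-- The set `{x ∈ {0,1}ⁿ | g_ℓ(x) ≥ 0 for all ℓ}` given by a family of linear constraints. -/
def integerSet {n : ℕ} {ι : Type*} (g : ι → (Fin n → ℝ) →ᵃ[ℝ] ℝ) : Set (Fin n → ℝ) :=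
  {x | x ∈ cube n ∧ ∀ l, 0 ≤ g l x}

/-- The `q`-zeta vector `Z_I`, indexed by the subsets `J` of size at most `q`:
its `J`-th entry is `1` if `J ⊆ I` and `0` otherwise. -/
def zetaVec {n : ℕ} (q : ℕ) (I : Finset (Fin n)) : {J : Finset (Fin n) // J.card ≤ q} → ℝ :=
  fun J => if J.1 ⊆ I then 1 else 0

/-- The matrix `∑_I w_I Z_I Z_Iᵀ`, where `Z_I` is the `q`-zeta vector of `I`. -/
noncomputable def zetaMatrix {n : ℕ} (q : ℕ) (w : Finset (Fin n) → ℝ) :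
    Matrix {J : Finset (Fin n) // J.card ≤ q} {J : Finset (Fin n) // J.card ≤ q} ℝ :=
  ∑ I : Finset (Fin n), w I • Matrix.vecMulVec (zetaVec q I) (zetaVec q I)

/-- The `t`-th round SoS (Lasserre) relaxation of the set given by the constraints `g`. -/
def SoS {n : ℕ} {ι : Type*} (g : ι → (Fin n → ℝ) →ᵃ[ℝ] ℝ) (t : ℕ) :
    Set (Finset (Fin n) → ℝ) :=
  {y | ∑ I : Finset (Fin n), y I = 1 ∧
    (zetaMatrix (t + 1) y).PosSemidef ∧
    ∀ l, (zetaMatrix t (fun I => g l (cubePoint I) * y I)).PosSemidef}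

/-- The projection to `ℝⁿ`: `x_i` is the sum of the `y_I` over all `I` containing `i`. -/
def proj {n : ℕ} (y : Finset (Fin n) → ℝ) : Fin n → ℝ :=
  fun i => ∑ I : Finset (Fin n) with i ∈ I, y I

/-- The levels at which the relaxation projects exactly to the integer hull. -/
def exactLevels {n : ℕ} {ι : Type*} (g : ι → (Fin n → ℝ) →ᵃ[ℝ] ℝ) : Set ℕ :=
  {t | proj '' SoS g t = convexHull ℝ (integerSet g)}

/-- The SoS rank: the smallest level at which the relaxation projects exactly to the
integer hull (meaningful when `exactLevels g` is nonempty). -/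
noncomputable def sosRank {n : ℕ} {ι : Type*} (g : ι → (Fin n → ℝ) →ᵃ[ℝ] ℝ) : ℕ :=
  sInf (exactLevels g)

/-- Laurent's set `K`, as a subset of `ℝⁿ`. -/
def laurentSet (n : ℕ) : Set (Fin n → ℝ) :=
  cube n ∩ {x | (∀ i, x i ∈ Set.Icc (0 : ℝ) 1) ∧
    ∀ R : Finset (Fin n), 1 / 2 ≤ ∑ r ∈ R, x r + ∑ r ∈ Rᶜ, (1 - x r)}

/-- The linear constraints of `K`, one for each `R ⊆ N`, in the form `g_R(x) ≥ 0`. -/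
noncomputable def laurentConstraint (n : ℕ) (R : Finset (Fin n)) : (Fin n → ℝ) →ᵃ[ℝ] ℝ :=
  ∑ r ∈ R, (LinearMap.proj (R := ℝ) (φ := fun _ : Fin n => ℝ) r).toAffineMap
    + ∑ r ∈ Rᶜ, (AffineMap.const ℝ (Fin n → ℝ) (1 : ℝ)
        - (LinearMap.proj (R := ℝ) (φ := fun _ : Fin n => ℝ) r).toAffineMap)
    - AffineMap.const ℝ (Fin n → ℝ) (1 / 2 : ℝ)

theorem laurentConstraint_apply (n : ℕ) (R : Finset (Fin n)) (x : Fin n → ℝ) :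
    laurentConstraint n R x = ∑ r ∈ R, x r + ∑ r ∈ Rᶜ, (1 - x r) - 1 / 2 := by
  have key : ∀ (S : Finset (Fin n)) (f : Fin n → ((Fin n → ℝ) →ᵃ[ℝ] ℝ)),
      (∑ r ∈ S, f r) x = ∑ r ∈ S, f r x := by
    intro S f
    induction S using Finset.induction_on with
    | empty => simp
    | insert a s ha ih => rw [Finset.sum_insert ha, Finset.sum_insert ha, ← ih]; rfl
  have h : laurentConstraint n R x =
      (∑ r ∈ R, (LinearMap.proj (R := ℝ) (φ := fun _ : Fin n => ℝ) r).toAffineMap) x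
      + (∑ r ∈ Rᶜ, (AffineMap.const ℝ (Fin n → ℝ) (1 : ℝ)
        - (LinearMap.proj (R := ℝ) (φ := fun _ : Fin n => ℝ) r).toAffineMap)) x - 1 / 2 := rfl
  rw [h, key, key]
  rfl

/-- The constraints `laurentConstraint n` do represent the set `K`. -/
theorem integerSet_laurentConstraint (n : ℕ) :
    integerSet (laurentConstraint n) = laurentSet n := by
  ext x
  simp only [integerSet, laurentSet, laurentConstraint_apply, Set.mem_inter_iff,
    Set.mem_ofPred_eq, sub_nonneg]
  refine ⟨fun h => ⟨h.1, fun i => ?_, h.2⟩, fun h => ⟨h.1, h.2.2⟩⟩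
  rcases h.1 i with hi | hi <;> simp [hi]

end SoSHierarchy

namespace SoSHierarchy

open Finset

variable {n : ℕ}

/-! Every 0/1 point violates the constraint centred at it, so `K` is empty and a level is exact
precisely when its relaxation is empty. On the cube a constraint reads `d(T, I) - 1/2 ≥ 0`, with `d`
the Hamming distance to `T = Rᶜ`, and positive semidefiniteness means nonnegativity against squares
of low degree functions.

Lower bound: the uniform `y` is feasible while `3t + 2 ≤ n`. Squares of degree `t` functions have
limited influence, so they cannot concentrate near `T` (`le_sum_indicator_mul_sq`,
`total_influence_le`). This gives a linear bound, stronger than the square root required.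

Upper bound: test each constraint with the square of one univariate polynomial `p` in `d(T, I)` and
sum over all `T`. The total no longer depends on `y`, so one negative binomial sum refutes
feasibility. Take `p(0) = 1` and let `p` vanish at all of `1, …, n` except a block `M` of about
`n^(1/3)/3` points near `n^(1/3)`. There `p` is so small that the term `-1/2` at `0` dominates. -/

/-! ### Low degree functions on the cube -/

/-- The functions on the cube spanned by the monomials of degree at most `q`. -/
def lowDegree (n q : ℕ) : Submodule ℝ (Finset (Fin n) → ℝ) :=
  Submodule.span ℝ {f | ∃ J : Finset (Fin n), J.card ≤ q ∧ f = fun I => if J ⊆ I then 1 else 0}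

theorem monomial_mem_lowDegree {q : ℕ} {J : Finset (Fin n)} (hJ : J.card ≤ q) :
    (fun I => if J ⊆ I then (1 : ℝ) else 0) ∈ lowDegree n q :=
  Submodule.subset_span ⟨J, hJ, rfl⟩

theorem lowDegree_mono {q r : ℕ} (h : q ≤ r) : lowDegree n q ≤ lowDegree n r := by
  refine Submodule.span_mono ?_
  rintro f ⟨J, hJ, rfl⟩
  exact ⟨J, hJ.trans h, rfl⟩

theorem sum_smul_zetaVec_mem_lowDegree (q : ℕ)
    (v : {J : Finset (Fin n) // J.card ≤ q} → ℝ) :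
    (fun I => ∑ J, v J * zetaVec q I J) ∈ lowDegree n q := by
  have h : (fun I => ∑ J, v J * zetaVec q I J) =
      ∑ J, v J • (fun I => if J.1 ⊆ I then (1 : ℝ) else 0) := by
    ext I
    simp [zetaVec]
  rw [h]
  exact Submodule.sum_mem _ fun J _ => Submodule.smul_mem _ _ (monomial_mem_lowDegree J.2)

theorem exists_coeff_of_mem_lowDegree {q : ℕ} {f : Finset (Fin n) → ℝ}
    (hf : f ∈ lowDegree n q) :
    ∃ v : {J : Finset (Fin n) // J.card ≤ q} → ℝ, ∀ I, f I = ∑ J, v J * zetaVec q I J := by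
  induction hf using Submodule.span_induction with
  | mem f hf =>
    obtain ⟨J, hJ, rfl⟩ := hf
    refine ⟨Pi.single ⟨J, hJ⟩ 1, fun I => ?_⟩
    rw [sum_eq_single ⟨J, hJ⟩ (fun K _ hK => by rw [Pi.single_eq_of_ne hK, zero_mul]) (by simp)]
    simp [zetaVec]
  | zero => exact ⟨0, fun I => by simp⟩
  | add f g _ _ hf hg =>
    obtain ⟨v, hv⟩ := hf
    obtain ⟨w, hw⟩ := hg
    exact ⟨v + w, fun I => by simp [hv, hw, add_mul, sum_add_distrib]⟩
  | smul c f _ hf =>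
    obtain ⟨v, hv⟩ := hf
    exact ⟨c • v, fun I => by simp [hv, mul_assoc, mul_sum]⟩

theorem dotProduct_zetaMatrix_mulVec (q : ℕ) (w : Finset (Fin n) → ℝ)
    (v : {J : Finset (Fin n) // J.card ≤ q} → ℝ) :
    dotProduct (star v) (Matrix.mulVec (zetaMatrix q w) v) =
      ∑ I, w I * (∑ J, v J * zetaVec q I J) ^ 2 := by
  rw [zetaMatrix, Matrix.sum_mulVec, dotProduct_sum]
  refine sum_congr rfl fun I _ => ?_
  rw [Matrix.smul_mulVec, dotProduct_smul, Matrix.vecMulVec_mulVec]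
  simp only [star_trivial, smul_eq_mul, dotProduct_smul, MulOpposite.smul_eq_mul_unop,
    MulOpposite.unop_op]
  rw [dotProduct_comm (zetaVec q I) v, sq]
  rfl

/-- The quadratic form at `v` is the `w`-weighted sum of squares of the polynomial with coefficients
`v`. -/
theorem posSemidef_zetaMatrix_iff (q : ℕ) (w : Finset (Fin n) → ℝ) :
    (zetaMatrix q w).PosSemidef ↔ ∀ f ∈ lowDegree n q, 0 ≤ ∑ I, w I * f I ^ 2 := by
  constructor
  · intro h f hf
    obtain ⟨v, hv⟩ := exists_coeff_of_mem_lowDegree hf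
    have := h.dotProduct_mulVec_nonneg v
    rw [dotProduct_zetaMatrix_mulVec] at this
    simpa only [hv] using this
  · intro h
    refine .of_dotProduct_mulVec_nonneg ?_ fun v => ?_
    · ext J J'
      simp [zetaMatrix, Matrix.sum_apply, Matrix.vecMulVec_apply, mul_comm]
    · rw [dotProduct_zetaMatrix_mulVec]
      exact h _ (sum_smul_zetaVec_mem_lowDegree q v)

theorem indicator_mul_mem_lowDegree {q : ℕ} {f : Finset (Fin n) → ℝ} (hf : f ∈ lowDegree n q)
    (i : Fin n) : (fun I => (if i ∈ I then 1 else 0) * f I) ∈ lowDegree n (q + 1) := by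
  induction hf using Submodule.span_induction with
  | mem f hf =>
    obtain ⟨J, hJ, rfl⟩ := hf
    convert monomial_mem_lowDegree (n := n) (q := q + 1) (J := insert i J)
      ((card_insert_le i J).trans (by omega)) using 2 with I
    by_cases h : i ∈ I <;> simp [h, insert_subset_iff]
  | zero =>
    convert Submodule.zero_mem (lowDegree n (q + 1)) using 1
    ext I
    simp
  | add f g _ _ hf hg =>
    convert Submodule.add_mem _ hf hg using 1
    ext I
    simp [mul_add]
  | smul c f _ hf =>
    convert Submodule.smul_mem _ c hf using 1
    ext I
    simp

/-! ### The constraints as Hamming distances -/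

theorem card_symmDiff_eq_sum (T I : Finset (Fin n)) :
    ((symmDiff T I).card : ℝ) = ∑ i, if i ∈ symmDiff T I then 1 else 0 := by
  simp

theorem laurentConstraint_cubePoint (R I : Finset (Fin n)) :
    laurentConstraint n R (cubePoint I) = ((symmDiff Rᶜ I).card : ℝ) - 1 / 2 := by
  rw [laurentConstraint_apply, card_symmDiff_eq_sum, ← sum_add_sum_compl R]
  congr 2
  · refine sum_congr rfl fun i hi => ?_
    simp [cubePoint, mem_symmDiff, hi]
  · refine sum_congr rfl fun i hi => ?_
    have hi' : i ∉ R := by simpa using hi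
    by_cases h : i ∈ I <;> simp [cubePoint, mem_symmDiff, hi', h]

theorem laurentSet_eq_empty (n : ℕ) : laurentSet n = ∅ := by
  classical
  rw [Set.eq_empty_iff_forall_notMem]
  rintro x ⟨hx, -, h⟩
  have := h (univ.filter fun i => x i = 0)
  rw [sum_eq_zero (fun i hi => (mem_filter.1 hi).2), sum_eq_zero] at this
  · norm_num at this
  · intro i hi
    have h0 : x i ≠ 0 := by simpa using hi
    rw [(hx i).resolve_left h0, sub_self]

theorem card_symmDiff_mul_mem_lowDegree {q : ℕ} {f : Finset (Fin n) → ℝ}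
    (hf : f ∈ lowDegree n q) (T : Finset (Fin n)) :
    (fun I => ((symmDiff T I).card : ℝ) * f I) ∈ lowDegree n (q + 1) := by
  have h : (fun I => ((symmDiff T I).card : ℝ) * f I) =
      ∑ i : Fin n, if i ∈ T then f - (fun I => (if i ∈ I then 1 else 0) * f I)
        else fun I => (if i ∈ I then 1 else 0) * f I := by
    ext I
    rw [card_symmDiff_eq_sum, sum_mul, Finset.sum_apply]
    refine sum_congr rfl fun i _ => ?_
    by_cases h : i ∈ T <;> by_cases h' : i ∈ I <;> simp [h, h', mem_symmDiff]
  rw [h]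
  refine Submodule.sum_mem _ fun i _ => ?_
  split_ifs
  · exact Submodule.sub_mem _ (lowDegree_mono (Nat.le_succ q) hf) (indicator_mul_mem_lowDegree hf i)
  · exact indicator_mul_mem_lowDegree hf i

/-- The product of `1 - d(T, I) / j` over `j ∈ A` has degree at most `|A|`. -/
theorem prod_mem_lowDegree (A : Finset ℕ) (T : Finset (Fin n)) :
    (fun I => ∏ j ∈ A, (1 - ((symmDiff T I).card : ℝ) / j)) ∈ lowDegree n A.card := by
  induction A using Finset.induction_on with
  | empty => simpa using monomial_mem_lowDegree (n := n) (q := 0) (J := ∅) (by simp)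
  | insert a A ha ih =>
    rw [card_insert_of_notMem ha]
    convert Submodule.sub_mem _ (lowDegree_mono (Nat.le_succ A.card) ih)
      (Submodule.smul_mem _ (a : ℝ)⁻¹ (card_symmDiff_mul_mem_lowDegree ih T)) using 1
    ext I
    rw [prod_insert ha]
    simp only [Pi.sub_apply, Pi.smul_apply, smul_eq_mul]
    ring

/-! ### Walsh expansion -/

/-- The Walsh character `χ_S`. -/
def walsh (S I : Finset (Fin n)) : ℝ := ∏ i ∈ S, if i ∈ I then -1 else 1

theorem walsh_symmDiff_singleton (S I : Finset (Fin n)) (i : Fin n) :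
    walsh S (symmDiff {i} I) = (if i ∈ S then -1 else 1) * walsh S I := by
  have h : ∀ j, (if j ∈ symmDiff {i} I then (-1 : ℝ) else 1) =
      (if j = i then -1 else 1) * (if j ∈ I then -1 else 1) := by
    intro j
    by_cases h : j = i <;> by_cases h' : j ∈ I <;> simp [mem_symmDiff, h, h']
  simp only [walsh, h, prod_mul_distrib]
  simp [prod_ite_eq']

theorem sum_comp_symmDiff_singleton (F : Finset (Fin n) → ℝ) (i : Fin n) :
    ∑ I, F (symmDiff {i} I) = ∑ I, F I :=
  Fintype.sum_bijective _ (symmDiff_right_injective {i} |>.bijective_of_finite) _ _ fun _ => rfl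

theorem sum_walsh_mul_walsh (S S' : Finset (Fin n)) :
    ∑ I, walsh S I * walsh S' I = if S = S' then 2 ^ n else 0 := by
  split_ifs with h
  · subst h
    have : ∀ I, walsh S I * walsh S I = 1 := by
      intro I
      rw [walsh, ← prod_mul_distrib]
      exact prod_eq_one fun i _ => by split_ifs <;> norm_num
    simp [this]
  · obtain ⟨i, hi⟩ : ∃ i, i ∈ symmDiff S S' := by
      by_contra! hc
      exact h (symmDiff_eq_bot.1 (eq_empty_of_forall_notMem hc))
    have h1 := sum_comp_symmDiff_singleton (fun I => walsh S I * walsh S' I) i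
    have h2 : ∑ I, walsh S (symmDiff {i} I) * walsh S' (symmDiff {i} I) =
        -∑ I, walsh S I * walsh S' I := by
      rw [← sum_neg_distrib]
      refine sum_congr rfl fun I _ => ?_
      rw [walsh_symmDiff_singleton, walsh_symmDiff_singleton]
      rcases mem_symmDiff.1 hi with h | h <;> simp [h.1, h.2]
    linarith

theorem sum_walsh_expansion_sq (c : Finset (Fin n) → ℝ) :
    ∑ I, (∑ S, c S * walsh S I) ^ 2 = 2 ^ n * ∑ S, c S ^ 2 := by
  calc ∑ I, (∑ S, c S * walsh S I) ^ 2
      = ∑ I, ∑ S, ∑ S', c S * c S' * (walsh S I * walsh S' I) := by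
        refine sum_congr rfl fun I _ => ?_
        rw [sq, sum_mul_sum]
        exact sum_congr rfl fun S _ => sum_congr rfl fun S' _ => by ring
    _ = ∑ S, ∑ S', c S * c S' * ∑ I, walsh S I * walsh S' I := by
        rw [sum_comm]
        refine sum_congr rfl fun S _ => ?_
        rw [sum_comm]
        exact sum_congr rfl fun S' _ => by rw [mul_sum]
    _ = 2 ^ n * ∑ S, c S ^ 2 := by
        simp only [sum_walsh_mul_walsh, mul_ite, mul_zero, sum_ite_eq, mem_univ, if_true, mul_sum]
        exact sum_congr rfl fun S _ => by ring

theorem exists_walsh_expansion {q : ℕ} {f : Finset (Fin n) → ℝ} (hf : f ∈ lowDegree n q) :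
    ∃ c : Finset (Fin n) → ℝ, (∀ S, q < S.card → c S = 0) ∧ ∀ I, f I = ∑ S, c S * walsh S I := by
  induction hf using Submodule.span_induction with
  | mem f hf =>
    obtain ⟨J, hJ, rfl⟩ := hf
    -- The coefficients come from expanding the product over `i ∈ J` of `(1 - χ_i) / 2`.
    refine ⟨fun S => if S ∈ J.powerset then (-1 / 2) ^ S.card * (1 / 2) ^ (J \ S).card else 0,
      fun S hS => if_neg fun h => ?_, fun I => ?_⟩
    · have := card_le_card (mem_powerset.1 h)
      omega
    · have h1 : (if J ⊆ I then (1 : ℝ) else 0) =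
          ∏ i ∈ J, (-1 / 2 * (if i ∈ I then -1 else 1) + 1 / 2) := by
        split_ifs with h
        · rw [prod_eq_one]
          intro i hi
          rw [if_pos (h hi)]
          norm_num
        · obtain ⟨i, hi, hi'⟩ := not_subset.1 h
          rw [prod_eq_zero hi]
          rw [if_neg hi']
          norm_num
      simp only [h1, prod_add, ite_mul, zero_mul, sum_ite_mem, univ_inter]
      refine sum_congr rfl fun S _ => ?_
      rw [prod_mul_distrib, prod_const, prod_const, walsh]
      ring
  | zero => exact ⟨0, fun _ _ => rfl, fun I => by simp⟩
  | add f g _ _ hf hg =>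
    obtain ⟨v, hv0, hv⟩ := hf
    obtain ⟨w, hw0, hw⟩ := hg
    exact ⟨v + w, fun S hS => by simp [hv0 S hS, hw0 S hS],
      fun I => by simp [hv, hw, add_mul, sum_add_distrib]⟩
  | smul c f _ hf =>
    obtain ⟨v, hv0, hv⟩ := hf
    exact ⟨c • v, fun S hS => by simp [hv0 S hS], fun I => by simp [hv, mul_assoc, mul_sum]⟩

/-- The total influence of a function of degree at most `q`. -/
theorem total_influence_le {q : ℕ} {f : Finset (Fin n) → ℝ} (hf : f ∈ lowDegree n q) :
    ∑ i, ∑ I, ((f I - f (symmDiff {i} I)) / 2) ^ 2 ≤ q * ∑ I, f I ^ 2 := by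
  obtain ⟨c, hc, hfc⟩ := exists_walsh_expansion hf
  have h1 : ∀ i I, (f I - f (symmDiff {i} I)) / 2 =
      ∑ S, (if i ∈ S then c S else 0) * walsh S I := by
    intro i I
    rw [hfc, hfc, ← sum_sub_distrib, sum_div]
    refine sum_congr rfl fun S _ => ?_
    rw [walsh_symmDiff_singleton]
    split_ifs <;> ring
  -- By Parseval each `c S ^ 2` is counted `|S| ≤ q` times, once for each `i ∈ S`.
  simp only [h1, sum_walsh_expansion_sq]
  simp only [hfc, sum_walsh_expansion_sq]
  rw [← mul_sum univ _ (2 ^ n : ℝ), sum_comm, mul_left_comm, mul_sum univ _ (q : ℝ)]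
  refine mul_le_mul_of_nonneg_left (sum_le_sum fun S _ => ?_)
    (by positivity : (0 : ℝ) ≤ 2 ^ n)
  by_cases hS : q < S.card
  · simp [hc S hS]
  · have h2 : ∑ i, (if i ∈ S then c S else 0) ^ 2 = S.card * c S ^ 2 := by
      simp [ite_pow]
    rw [h2]
    have : (S.card : ℝ) ≤ q := by exact_mod_cast not_lt.1 hS
    gcongr

/-! ### Feasibility at low levels -/

theorem indicator_symmDiff_flip (T I : Finset (Fin n)) (i : Fin n) :
    (if i ∈ symmDiff T (symmDiff {i} I) then (1 : ℝ) else 0) =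
      1 - if i ∈ symmDiff T I then 1 else 0 := by
  by_cases h : i ∈ T <;> by_cases h' : i ∈ I <;> simp [h, h', mem_symmDiff]

/-- Split `f = a + b` into parts even and odd under flipping `i`. Both squares are flip-invariant,
so the indicator, which the flip complements, averages to `1/2` against them. -/
theorem le_sum_indicator_mul_sq (f : Finset (Fin n) → ℝ) (T : Finset (Fin n)) (i : Fin n) :
    1 / 4 * ∑ I, f I ^ 2 - 3 / 4 * ∑ I, ((f I - f (symmDiff {i} I)) / 2) ^ 2 ≤
      ∑ I, (if i ∈ symmDiff T I then 1 else 0) * f I ^ 2 := by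
  set h : Finset (Fin n) → ℝ := fun I => if i ∈ symmDiff T I then 1 else 0 with hh
  have hflip : ∀ I, h (symmDiff {i} I) = 1 - h I := fun I => indicator_symmDiff_flip T I i
  have h0 : ∀ I, 0 ≤ h I := fun I => by simp only [hh]; split_ifs <;> norm_num
  set a : Finset (Fin n) → ℝ := fun I => (f I + f (symmDiff {i} I)) / 2 with ha
  set b : Finset (Fin n) → ℝ := fun I => (f I - f (symmDiff {i} I)) / 2 with hb
  have hsum : ∑ I, a I ^ 2 + ∑ I, b I ^ 2 = ∑ I, f I ^ 2 := by
    have h1 := sum_comp_symmDiff_singleton (fun I => f I ^ 2) i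
    have h2 : ∑ I, a I ^ 2 + ∑ I, b I ^ 2 =
        1 / 2 * ∑ I, f I ^ 2 + 1 / 2 * ∑ I, f (symmDiff {i} I) ^ 2 := by
      rw [← sum_add_distrib, mul_sum, mul_sum, ← sum_add_distrib]
      exact sum_congr rfl fun I _ => by simp only [ha, hb]; ring
    linarith
  have hhalf : ∑ I, h I * (1 / 2 * a I ^ 2 - b I ^ 2) =
      1 / 2 * ∑ I, (1 / 2 * a I ^ 2 - b I ^ 2) := by
    have h1 := sum_comp_symmDiff_singleton (fun I => h I * (1 / 2 * a I ^ 2 - b I ^ 2)) i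
    have h2 : ∑ I, h (symmDiff {i} I) *
        (1 / 2 * a (symmDiff {i} I) ^ 2 - b (symmDiff {i} I) ^ 2) =
        ∑ I, (1 / 2 * a I ^ 2 - b I ^ 2) - ∑ I, h I * (1 / 2 * a I ^ 2 - b I ^ 2) := by
      rw [← sum_sub_distrib]
      refine sum_congr rfl fun I _ => ?_
      simp only [ha, hb, hflip, symmDiff_symmDiff_cancel_left]
      ring
    linarith
  have hle : ∑ I, h I * (1 / 2 * a I ^ 2 - b I ^ 2) ≤ ∑ I, h I * f I ^ 2 := by
    refine sum_le_sum fun I _ => mul_le_mul_of_nonneg_left ?_ (h0 I)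
    have : f I = a I + b I := by simp only [ha, hb]; ring
    rw [this]
    -- `(a + b)² - (a²/2 - b²) = (a + 2b)²/2`.
    nlinarith [sq_nonneg (a I + 2 * b I)]
  rw [sum_sub_distrib, ← mul_sum] at hhalf
  linarith

theorem SoS_laurentConstraint_nonempty {t : ℕ} (h : 3 * t + 2 ≤ n) :
    (SoS (laurentConstraint n) t).Nonempty := by
  refine ⟨fun _ => (2 ^ n)⁻¹, by simp, ?_, fun R => ?_⟩
  · rw [posSemidef_zetaMatrix_iff]
    exact fun f _ => sum_nonneg fun I _ => by positivity
  · rw [posSemidef_zetaMatrix_iff]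
    intro f hf
    have h1 := sum_le_sum fun i (_ : i ∈ univ) => le_sum_indicator_mul_sq f Rᶜ i
    rw [sum_sub_distrib, ← mul_sum univ _ (3 / 4 : ℝ), sum_const, card_univ, Fintype.card_fin, nsmul_eq_mul]
      at h1
    have h2 := total_influence_le hf
    have h3 : 0 ≤ ∑ I, f I ^ 2 := sum_nonneg fun I _ => sq_nonneg _
    have h4 : (3 * t + 2 : ℝ) ≤ n := by exact_mod_cast h
    have h5 : ∑ I, laurentConstraint n R (cubePoint I) * (2 ^ n)⁻¹ * f I ^ 2 =
        (2 ^ n)⁻¹ * (∑ I, ∑ i, (if i ∈ symmDiff Rᶜ I then 1 else 0) * f I ^ 2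
          - 1 / 2 * ∑ I, f I ^ 2) := by
      rw [mul_sum, ← sum_sub_distrib, mul_sum]
      refine sum_congr rfl fun I _ => ?_
      rw [laurentConstraint_cubePoint, card_symmDiff_eq_sum, ← sum_mul]
      ring
    rw [h5, sum_comm]
    refine mul_nonneg (by positivity) ?_
    -- What remains is `n/4 - 3t/4 ≥ 1/2`, which is where `3t + 2 ≤ n` comes from.
    nlinarith [mul_le_mul_of_nonneg_right h4 h3]

/-! ### Infeasibility at high levels -/

theorem SoS_laurentConstraint_eq_empty_of_prod (A : Finset ℕ)
    (h : ∑ k ∈ range (n + 1), (n.choose k : ℝ) *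
      (((k : ℝ) - 1 / 2) * (∏ j ∈ A, (1 - (k : ℝ) / j)) ^ 2) < 0) :
    SoS (laurentConstraint n) A.card = ∅ := by
  rw [Set.eq_empty_iff_forall_notMem]
  rintro y ⟨hy, -, hR⟩
  set F : ℕ → ℝ := fun k => ((k : ℝ) - 1 / 2) * (∏ j ∈ A, (1 - (k : ℝ) / j)) ^ 2 with hF
  have h1 : ∀ R : Finset (Fin n), 0 ≤ ∑ I, y I * F (symmDiff Rᶜ I).card := by
    intro R
    have := (posSemidef_zetaMatrix_iff _ _).1 (hR R) _ (prod_mem_lowDegree A Rᶜ)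
    refine this.trans_eq (sum_congr rfl fun I _ => ?_)
    rw [laurentConstraint_cubePoint, hF]
    ring
  have h2 : ∀ I : Finset (Fin n), ∑ R : Finset (Fin n), F (symmDiff Rᶜ I).card =
      ∑ k ∈ range (n + 1), (n.choose k : ℝ) * F k := by
    intro I
    -- For fixed `I` the difference sweeps every subset once, so the sum is independent of `I`.
    rw [Fintype.sum_bijective (fun R : Finset (Fin n) => symmDiff Rᶜ I)
      ((symmDiff_left_injective I).comp compl_injective).bijective_of_finite _
      (fun J => F J.card) (fun _ => rfl)]
    have := sum_powerset_apply_card F (x := (univ : Finset (Fin n)))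
    rw [powerset_univ, card_univ, Fintype.card_fin] at this
    simpa only [nsmul_eq_mul] using this
  have h3 : 0 ≤ ∑ R : Finset (Fin n), ∑ I, y I * F (symmDiff Rᶜ I).card :=
    sum_nonneg fun R _ => h1 R
  rw [sum_comm] at h3
  simp only [← mul_sum, h2] at h3
  rw [← sum_mul, hy, one_mul] at h3
  exact absurd h3 (not_le.2 h)

theorem prod_Ico_div_sub_one (m : ℕ) : ∏ j ∈ Ico 1 m, |1 - (m : ℝ) / j| = 1 := by
  have h1 : ∏ j ∈ Ico 1 m, ((m - j : ℕ) : ℝ) = ∏ j ∈ Ico 1 m, (j : ℝ) := by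
    rw [prod_Ico_reflect (fun j => (j : ℝ)) 1 (Nat.le_succ m)]
    simp
  have h2 : ∀ j ∈ Ico 1 m, |1 - (m : ℝ) / j| = ((m - j : ℕ) : ℝ) / j := by
    intro j hj
    rw [mem_Ico] at hj
    have hj0 : (0 : ℝ) < j := by exact_mod_cast hj.1
    have hjm : (j : ℝ) ≤ m := by exact_mod_cast hj.2.le
    rw [Nat.cast_sub hj.2.le, abs_sub_comm, abs_of_nonneg]
    · field_simp
    · rw [sub_nonneg, le_div_iff₀ hj0]
      linarith
  rw [prod_congr rfl h2, prod_div_distrib, h1, div_self]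
  exact prod_ne_zero_iff.2 fun j hj => by
    rw [mem_Ico] at hj
    exact_mod_cast (by omega : j ≠ 0)

/-- For `m ≥ 1` the product of `|j - m| / j` is `m! (n - m)! / n!`; for `m = 0` both factors are
`1`. -/
theorem prod_erase_mul_choose {m : ℕ} (hmn : m ≤ n) :
    (∏ j ∈ (Icc 1 n).erase m, |1 - (m : ℝ) / j|) * n.choose m = 1 := by
  induction n, hmn using Nat.le_induction with
  | base =>
    have : (Icc 1 m).erase m = Ico 1 m := by
      ext j
      simp only [mem_erase, mem_Icc, mem_Ico]
      omega
    rw [this, prod_Ico_div_sub_one]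
    simp
  | succ n hn ih =>
    have h1 : (Icc 1 (n + 1)).erase m = insert (n + 1) ((Icc 1 n).erase m) := by
      ext j
      simp only [mem_erase, mem_Icc, mem_insert]
      omega
    have h2 : ((n.choose m : ℕ) : ℝ) * (n + 1) = (n + 1).choose m * (n + 1 - m) := by
      have := congrArg (Nat.cast (R := ℝ)) (Nat.choose_mul_succ_eq n m)
      rw [Nat.cast_mul, Nat.cast_mul, Nat.cast_sub (by omega)] at this
      exact_mod_cast this
    have hnm : (m : ℝ) ≤ n := by exact_mod_cast hn
    have h3 : |1 - (m : ℝ) / (n + 1 : ℕ)| = (n + 1 - m) / (n + 1) := by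
      push_cast
      rw [one_sub_div (by positivity), abs_of_nonneg]
      exact div_nonneg (by linarith) (by positivity)
    rw [h1, prod_insert (by simp), h3]
    calc (n + 1 - m : ℝ) / (n + 1) * (∏ j ∈ (Icc 1 n).erase m, |1 - (m : ℝ) / j|)
          * (n + 1).choose m
        = (∏ j ∈ (Icc 1 n).erase m, |1 - (m : ℝ) / j|) *
            ((n + 1).choose m * (n + 1 - m)) / (n + 1) := by ring
      _ = (∏ j ∈ (Icc 1 n).erase m, |1 - (m : ℝ) / j|) * n.choose m := by
          rw [← h2]
          field_simp
      _ = 1 := ih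

theorem pow_le_choose_of_cube_le {a m : ℕ} (ha : 2 ≤ a) (hm : m ≤ a) (hn : a ^ 3 ≤ n) :
    a ^ m ≤ n.choose m := by
  have h1 : a ^ m * m.factorial ≤ n.choose m * m.factorial := by
    calc a ^ m * m.factorial ≤ a ^ m * a ^ m := by
          refine Nat.mul_le_mul_left _ ((Nat.factorial_le_pow m).trans ?_)
          exact Nat.pow_le_pow_left hm m
      _ = (a * a) ^ m := (mul_pow a a m).symm
      _ ≤ (n + 1 - m) ^ m := by
          refine Nat.pow_le_pow_left ?_ m
          have : a * a + a ≤ a ^ 3 := by nlinarith [Nat.mul_le_mul_right (a * a) ha]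
          omega
      _ ≤ n.descFactorial m := Nat.pow_sub_le_descFactorial n m
      _ = n.choose m * m.factorial := by
          rw [Nat.descFactorial_eq_factorial_mul_choose, mul_comm]
  exact Nat.le_of_mul_le_mul_right h1 m.factorial_pos

/-- The values at `m ∈ M` of the product over the complement of `M`. -/
theorem abs_prod_sdiff_mul_choose_le {a m : ℕ} {M : Finset ℕ} (hM : M ⊆ Icc 1 n)
    (hMa : ∀ j ∈ M, j ≤ a) (hm : m ∈ M) :
    |∏ j ∈ Icc 1 n \ M, (1 - (m : ℝ) / j)| * n.choose m ≤ (a : ℝ) ^ (M.card - 1) := by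
  have hm' := mem_Icc.1 (hM hm)
  have key := prod_erase_mul_choose hm'.2
  have hsplit : (Icc 1 n).erase m = (Icc 1 n \ M) ∪ M.erase m := by
    ext j
    have := @hM j
    by_cases hj : j ∈ M <;> simp_all
    rintro _ _ rfl
    exact hj hm
  have hdisj : Disjoint (Icc 1 n \ M) (M.erase m) :=
    disjoint_sdiff_self_left.mono_right (erase_subset m M)
  have ha : (0 : ℝ) < a := by exact_mod_cast hm'.1.trans (hMa m hm)
  have hlow : ((a : ℝ)⁻¹) ^ (M.card - 1) ≤ ∏ j ∈ M.erase m, |1 - (m : ℝ) / j| := by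
    rw [← card_erase_of_mem hm, ← prod_const]
    -- Distinct integers differ by at least `1`, so each factor `|j - m| / j` is at least `1 / a`.
    refine prod_le_prod (fun _ _ => by positivity) fun j hj => ?_
    obtain ⟨hjm, hjM⟩ := mem_erase.1 hj
    have hj0 : (0 : ℝ) < j := by exact_mod_cast (mem_Icc.1 (hM hjM)).1
    have hja : (j : ℝ) ≤ a := by exact_mod_cast hMa j hjM
    have h1 : (1 : ℝ) ≤ |(j : ℝ) - m| := by
      have : (1 : ℤ) ≤ |(j : ℤ) - m| := Int.one_le_abs (by omega)
      exact_mod_cast this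
    rw [one_sub_div hj0.ne', abs_div, abs_of_pos hj0, inv_eq_one_div]
    gcongr
  rw [hsplit, prod_union hdisj, ← abs_prod] at key
  set p := |∏ j ∈ Icc 1 n \ M, (1 - (m : ℝ) / j)| with hp
  have hpc : 0 ≤ p * n.choose m := by positivity
  have h2 : p * n.choose m * ((a : ℝ)⁻¹) ^ (M.card - 1) ≤ 1 := by
    calc p * n.choose m * ((a : ℝ)⁻¹) ^ (M.card - 1)
        ≤ p * n.choose m * ∏ j ∈ M.erase m, |1 - (m : ℝ) / j| := by gcongr
      _ = 1 := by rw [mul_right_comm]; exact key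
  rwa [inv_pow, ← div_eq_mul_inv, div_le_one (by positivity)] at h2

theorem SoS_laurentConstraint_eq_empty {a : ℕ} (ha : 3 ≤ a) (hn : a ^ 3 ≤ n) :
    SoS (laurentConstraint n) (n - a / 3) = ∅ := by
  set s := a / 3 with hs
  have hs1 : 1 ≤ s := by omega
  have han : a ≤ n := (Nat.le_self_pow (by norm_num) a).trans hn
  -- Omitting `s` roots lowers the degree to `n - s` at the cost of a factor `a ^ (s - 1)`. Placing
  -- `M` at the top of `[1, a]` makes `n.choose m ≥ a ^ m` large enough to absorb its square.
  set M := Ioc (a - s) a with hMdef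
  have hM : M ⊆ Icc 1 n := by
    intro j
    simp only [hMdef, mem_Ioc, mem_Icc]
    omega
  have hMa : ∀ j ∈ M, j ≤ a := fun j hj => (mem_Ioc.1 hj).2
  have hMcard : M.card = s := by
    rw [hMdef, Nat.card_Ioc]
    omega
  have hcard : (Icc 1 n \ M).card = n - s := by
    rw [card_sdiff_of_subset hM, hMcard, Nat.card_Icc]
    omega
  rw [← hcard]
  apply SoS_laurentConstraint_eq_empty_of_prod
  set F : ℕ → ℝ := fun k => (n.choose k : ℝ) *
      (((k : ℝ) - 1 / 2) * (∏ j ∈ Icc 1 n \ M, (1 - (k : ℝ) / j)) ^ 2) with hF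
  have ha0 : (0 : ℝ) < a := by exact_mod_cast (by omega : 0 < a)
  have hzero : F 0 = -(1 / 2) := by simp [hF]
  have hvanish : ∀ k ∈ range (n + 1), k ∉ insert 0 M → F k = 0 := by
    intro k hk hkM
    rw [mem_insert, not_or] at hkM
    have hk' : k ∈ Icc 1 n \ M := by
      rw [mem_sdiff, mem_Icc]
      exact ⟨⟨by omega, by simpa [Nat.lt_succ_iff] using hk⟩, hkM.2⟩
    have : ∏ j ∈ Icc 1 n \ M, (1 - (k : ℝ) / j) = 0 := by
      refine prod_eq_zero hk' ?_
      rw [div_self (by exact_mod_cast hkM.1), sub_self]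
    simp [hF, this]
  have hsub : insert 0 M ⊆ range (n + 1) := by
    intro j hj
    rcases mem_insert.1 hj with rfl | hj
    · simp
    · have := (mem_Icc.1 (hM hj)).2
      simpa [Nat.lt_succ_iff] using this
  have hsmall : ∀ m ∈ M, F m ≤ (a : ℝ)⁻¹ ^ 2 := by
    intro m hm
    obtain ⟨hm1, hm2⟩ := mem_Ioc.1 hm
    have h1 := abs_prod_sdiff_mul_choose_le hM hMa hm
    rw [hMcard] at h1
    have h2 : (a : ℝ) ^ m ≤ n.choose m := by
      exact_mod_cast pow_le_choose_of_cube_le (by omega) hm2 hn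
    set p := ∏ j ∈ Icc 1 n \ M, (1 - (m : ℝ) / j) with hp
    have hc : (0 : ℝ) < n.choose m := lt_of_lt_of_le (by positivity) h2
    have h3 : (n.choose m : ℝ) * (n.choose m * p ^ 2) ≤ (a : ℝ) ^ (2 * (s - 1)) := by
      calc (n.choose m : ℝ) * (n.choose m * p ^ 2) = (|p| * n.choose m) ^ 2 := by
            rw [mul_pow, sq_abs]; ring
        _ ≤ ((a : ℝ) ^ (s - 1)) ^ 2 := by gcongr
        _ = (a : ℝ) ^ (2 * (s - 1)) := by rw [← pow_mul, mul_comm]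
    have h4 : (a : ℝ) ^ m * (n.choose m * p ^ 2) ≤ (a : ℝ) ^ (2 * (s - 1)) :=
      (mul_le_mul_of_nonneg_right h2 (by positivity)).trans h3
    have h5 : F m ≤ a * (n.choose m * p ^ 2) := by
      have : (m : ℝ) ≤ a := by exact_mod_cast hm2
      calc F m = ((m : ℝ) - 1 / 2) * (n.choose m * p ^ 2) := by simp only [hF, ← hp]; ring
        _ ≤ a * (n.choose m * p ^ 2) := by gcongr; linarith
    have h6 : (a : ℝ) ^ m * (a * (n.choose m * p ^ 2)) ≤ (a : ℝ) ^ m * (a : ℝ)⁻¹ ^ 2 := by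
      calc (a : ℝ) ^ m * (a * (n.choose m * p ^ 2))
          = a * ((a : ℝ) ^ m * (n.choose m * p ^ 2)) := by ring
        _ ≤ a * (a : ℝ) ^ (2 * (s - 1)) := by gcongr
        _ = (a : ℝ) ^ (2 * s - 1) := by
            rw [← pow_succ']
            congr 1
            omega
        -- `m ≥ a - s + 1 ≥ 2s + 1`, as `s = a / 3`.
        _ ≤ (a : ℝ) ^ (m - 2) := pow_le_pow_right₀ (by exact_mod_cast (by omega)) (by omega)
        _ = (a : ℝ) ^ m * (a : ℝ)⁻¹ ^ 2 := by
            rw [inv_pow, pow_sub₀ _ ha0.ne' (by omega)]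
    exact h5.trans (le_of_mul_le_mul_left h6 (by positivity))
  have h0M : 0 ∉ M := fun h => by
    have := (mem_Icc.1 (hM h)).1
    omega
  rw [← sum_subset hsub hvanish, sum_insert h0M, hzero]
  have h7 : ∑ m ∈ M, F m ≤ s * (a : ℝ)⁻¹ ^ 2 := by
    refine (sum_le_sum hsmall).trans_eq ?_
    rw [sum_const, hMcard, nsmul_eq_mul]
  have h8 : (s : ℝ) * (a : ℝ)⁻¹ ^ 2 ≤ 1 / 3 := by
    have h3s : (3 * s : ℝ) ≤ a := by exact_mod_cast (by omega : 3 * s ≤ a)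
    have h3a : (3 : ℝ) ≤ a := by exact_mod_cast ha
    rw [inv_pow, ← div_eq_mul_inv, div_le_iff₀ (by positivity)]
    nlinarith
  linarith

/-! ### The rank -/

theorem mem_exactLevels_laurentConstraint_iff (t : ℕ) :
    t ∈ exactLevels (laurentConstraint n) ↔ SoS (laurentConstraint n) t = ∅ := by
  simp [exactLevels, integerSet_laurentConstraint, laurentSet_eq_empty]

theorem mem_exactLevels_of_cube_le {a : ℕ} (ha : 3 ≤ a) (hn : a ^ 3 ≤ n) :
    n - a / 3 ∈ exactLevels (laurentConstraint n) :=
  (mem_exactLevels_laurentConstraint_iff _).2 (SoS_laurentConstraint_eq_empty ha hn)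

theorem sosRank_le_of_cube_le {a : ℕ} (ha : 3 ≤ a) (hn : a ^ 3 ≤ n) :
    sosRank (laurentConstraint n) + a / 3 ≤ n := by
  have h1 : sosRank (laurentConstraint n) ≤ n - a / 3 :=
    Nat.sInf_le (mem_exactLevels_of_cube_le ha hn)
  have h2 : a ≤ n := (Nat.le_self_pow (by norm_num) a).trans hn
  omega

theorem lt_three_mul_sosRank (h : (exactLevels (laurentConstraint n)).Nonempty) :
    n < 3 * sosRank (laurentConstraint n) + 2 := by
  have h1 := (mem_exactLevels_laurentConstraint_iff _).1 (Nat.sInf_mem h)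
  by_contra! hc
  exact (SoS_laurentConstraint_nonempty hc).ne_empty h1

end SoSHierarchy

theorem mainTheorem2 :
    (∀ n : ℕ, SoSHierarchy.laurentSet n = ∅) ∧
    (∃ c : ℝ, 0 < c ∧ ∃ C : ℝ, 0 < C ∧ ∃ n₀ : ℕ, ∀ n : ℕ, n₀ ≤ n →
      (SoSHierarchy.exactLevels (SoSHierarchy.laurentConstraint n)).Nonempty ∧
      c * Real.sqrt n ≤ (SoSHierarchy.sosRank (SoSHierarchy.laurentConstraint n) : ℝ) ∧
      (SoSHierarchy.sosRank (SoSHierarchy.laurentConstraint n) : ℝ)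
        ≤ (n : ℝ) - C * (n : ℝ) ^ (1 / 3 : ℝ)) ∧
    (∃ n₁ : ℕ, ∀ n : ℕ, n₁ ≤ n →
      SoSHierarchy.sosRank (SoSHierarchy.laurentConstraint n) + 1 < n) := by
  -- `216 = 6 ^ 3`: taking `a = 6` already gives rank at most `n - 2`. With `a = ⌊x⌋` and `x =
  -- n^(1/3) ≥ 6`, `a / 3 ≥ (a - 2) / 3 > (x - 3) / 3 ≥ x / 6`.
  refine ⟨SoSHierarchy.laurentSet_eq_empty, ⟨1, one_pos, 1 / 6, by norm_num, 216, fun n hn => ?_⟩,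
    216, fun n hn => ?_⟩
  · have hne : (SoSHierarchy.exactLevels (SoSHierarchy.laurentConstraint n)).Nonempty :=
      ⟨_, SoSHierarchy.mem_exactLevels_of_cube_le (a := 6) (by norm_num) hn⟩
    have hn' : (216 : ℝ) ≤ n := by exact_mod_cast hn
    refine ⟨hne, ?_, ?_⟩
    · have h1 : (n : ℝ) < 3 * SoSHierarchy.sosRank (SoSHierarchy.laurentConstraint n) + 2 := by
        exact_mod_cast SoSHierarchy.lt_three_mul_sosRank hne
      have h2 : (14 : ℝ) ≤ Real.sqrt n := Real.le_sqrt_of_sq_le (by linarith)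
      have h3 : Real.sqrt n * Real.sqrt n = n := Real.mul_self_sqrt (by positivity)
      nlinarith
    · set x : ℝ := (n : ℝ) ^ (1 / 3 : ℝ) with hx
      have hx0 : 0 ≤ x := by positivity
      have hx3 : x ^ 3 = n := by
        rw [hx, ← Real.rpow_natCast, ← Real.rpow_mul (by positivity)]
        norm_num
      have hx6 : 6 ≤ x := by
        by_contra! hc
        have : x ^ 3 < 6 ^ 3 := pow_lt_pow_left₀ hc hx0 (by norm_num)
        linarith
      have ha6 : 6 ≤ ⌊x⌋₊ := Nat.le_floor (by exact_mod_cast hx6)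
      have han : ⌊x⌋₊ ^ 3 ≤ n := by
        have : (⌊x⌋₊ : ℝ) ^ 3 ≤ n := by
          rw [← hx3]
          exact pow_le_pow_left₀ (by positivity) (Nat.floor_le hx0) 3
        exact_mod_cast this
      have h1 := SoSHierarchy.sosRank_le_of_cube_le (by omega) han
      have h2 : (SoSHierarchy.sosRank (SoSHierarchy.laurentConstraint n) : ℝ)
          + (⌊x⌋₊ / 3 : ℕ) ≤ n := by exact_mod_cast h1
      have h3 : (⌊x⌋₊ : ℝ) ≤ 3 * (⌊x⌋₊ / 3 : ℕ) + 2 := by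
        exact_mod_cast (by omega : ⌊x⌋₊ ≤ 3 * (⌊x⌋₊ / 3) + 2)
      have h4 := Nat.lt_floor_add_one x
      linarith
  · have := SoSHierarchy.sosRank_le_of_cube_le (n := n) (a := 6) (by norm_num) hn
    omega
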